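/- **Model.** The input is a list of $n$ distinct points $x_1,\dots,x_n$ in the plane, accessible only through a noisy three-point orientation test. A call names an ordered triple of distinct indices $(i,j,k)$; its correct answer is $0$ if $x_i,x_j,x_k$ are collinear, and otherwise $+1$ or $-1$ according to whether they are in counterclockwise or clockwise order around their triangle. Each call, including a repeated call on the same triple, is erroneous independently with probability $p$; a call that is not erroneous returns the correct answer, while an erroneous call on $(i,j,k)$ returns an incorrect answer $w(i,j,k)\in\{-1,0,+1\}$, where the function $w$ is chosen by an adversary and may depend on the input. A randomized algorithm may choose each call adaptively, depending on its random bits (independent of the errors) and the answers received so far, may perform arbitrary computation between calls, and either halts with a yes/no output or runs forever. **Theorem.** Let $0<p<\tfrac12$ and $c>0$. There are $C>0$ and $N\in\mathbb N$, depending only on $p$ and $c$, such that the following holds for every $n\ge N$. Let $A$ be a randomized algorithm which, for every set of $n$ distinct points in the plane and every choice of $w$, halts and correctly determines whether three of the points are collinear, with probability at least $1-n^{-c}$. Then for some set of $n$ distinct points and some choice of $w$, the expected number of calls that $A$ makes to the test is at least $C\,n^2\log n$. -/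

import Mathlib

open MeasureTheory ProbabilityTheory
open scoped ENNReal

universe u

namespace NoisyCollinearity

/-- The Euclidean plane. -/
abbrev Plane : Type := EuclideanSpace ℝ (Fin 2)

/-- The orientation of an ordered triple of points: `0` if they are collinear, `1` if they are in
counterclockwise order around their triangle, `-1` if they are in clockwise order. -/
noncomputable def orientation (a b c : Plane) : SignType :=
  SignType.sign ((b 0 - a 0) * (c 1 - a 1) - (b 1 - a 1) * (c 0 - a 0))

/-- An input of `n` points contains three (distinct) collinear points. -/
def HasCollinearTriple {n : ℕ} (x : Fin n → Plane) : Prop :=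
  ∃ i j k : Fin n, i ≠ j ∧ i ≠ k ∧ j ≠ k ∧ Collinear ℝ {x i, x j, x k}

/-- A call to the orientation test names an ordered triple of distinct input points. -/
abbrev Query (n : ℕ) : Type := Fin 3 ↪ Fin n

/-- The correct answer of the three-point orientation test on the input `x`. -/
noncomputable def trueAnswer {n : ℕ} (x : Fin n → Plane) (q : Query n) : SignType :=
  orientation (x (q 0)) (x (q 1)) (x (q 2))

/-- `w` is an admissible choice, made by an adversary, of the answers returned by erroneous calls
on the input `x`: each of these answers is incorrect. -/
def IsErrorRule {n : ℕ} (x : Fin n → Plane) (w : Query n → SignType) : Prop :=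
  ∀ q, w q ≠ trueAnswer x q

/-- The answer of the noisy test to the call `q` on the input `x`, where `err` says whether this
call is erroneous and `w` gives the erroneous answers. -/
noncomputable def noisyAnswer {n : ℕ} (x : Fin n → Plane) (w : Query n → SignType)
    (q : Query n) (err : Bool) : SignType :=
  if err = true then w q else trueAnswer x q

/-- A randomized algorithm for inputs of `n` points, whose only access to the input is through
calls to the test. It draws a random seed once. Depending on the seed and on the list of answers
received so far (in chronological order), it either makes a further call (`Sum.inl q`) or halts
with output `b` (`Sum.inr b`). No bound is put on the computation between two calls. A
deterministic algorithm is one that ignores its seed. -/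
structure RandomizedAlgorithm (n : ℕ) where
  Seed : Type u
  [measurableSpaceSeed : MeasurableSpace Seed]
  seedLaw : Measure Seed
  [isProbabilityMeasure_seedLaw : IsProbabilityMeasure seedLaw]
  next : Seed → List SignType → Query n ⊕ Bool
  measurableSet_next : ∀ (h : List SignType) (a : Query n ⊕ Bool),
    MeasurableSet {s | next s h = a}

attribute [instance] RandomizedAlgorithm.measurableSpaceSeed
  RandomizedAlgorithm.isProbabilityMeasure_seedLaw

namespace RandomizedAlgorithm

variable {n : ℕ} (A : RandomizedAlgorithm.{u} n)

/-- The list of the answers received during the first `k` steps of the run with seed `s`, where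
`e i` says whether the `i`-th call is erroneous. The list stops growing once `A` has halted. -/
noncomputable def answers (x : Fin n → Plane) (w : Query n → SignType)
    (s : A.Seed) (e : ℕ → Bool) : ℕ → List SignType
  | 0 => []
  | k + 1 =>
    match A.next s (answers x w s e k) with
    | Sum.inl q => answers x w s e k ++ [noisyAnswer x w q (e k)]
    | Sum.inr _ => answers x w s e k

/-- The run with seed `s` and error pattern `e` halts with output `b`. -/
def Outputs (x : Fin n → Plane) (w : Query n → SignType)
    (s : A.Seed) (e : ℕ → Bool) (b : Bool) : Prop :=
  ∃ k : ℕ, A.next s (A.answers x w s e k) = Sum.inr b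

/-- The total number of calls made by the run with seed `s` and error pattern `e`
(infinite if the run does not halt). -/
noncomputable def numCalls (x : Fin n → Plane) (w : Query n → SignType)
    (s : A.Seed) (e : ℕ → Bool) : ℝ≥0∞ :=
  ⨆ k : ℕ, ((A.answers x w s e k).length : ℝ≥0∞)

/-- The joint law of the seed and the error pattern: the calls are erroneous independently of each
other and of the seed, each with probability `p`. -/
noncomputable def runLaw (p : unitInterval) : Measure (A.Seed × (ℕ → Bool)) :=
  A.seedLaw.prod (Measure.infinitePi fun _ : ℕ => bernoulliMeasure true false p)

/-- The probability that `A`, run on the input `x` with error probability `p` and erroneous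
answers `w`, halts and correctly says whether `x` has three collinear points. -/
noncomputable def successProb (p : unitInterval) (x : Fin n → Plane)
    (w : Query n → SignType) : ℝ≥0∞ :=
  A.runLaw p {r | ∃ b : Bool, A.Outputs x w r.1 r.2 b ∧ (b = true ↔ HasCollinearTriple x)}

/-- The expected number of calls made by `A`. -/
noncomputable def expectedCalls (p : unitInterval) (x : Fin n → Plane)
    (w : Query n → SignType) : ℝ≥0∞ :=
  ∫⁻ r, A.numCalls x w r.1 r.2 ∂(A.runLaw p)

/-- `A` determines whether `n` distinct points have three collinear ones with failure probability
at most `n ^ (-c)`, for every input and every choice of the erroneous answers. -/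
def SolvesWithHighProbability (p : unitInterval) (c : ℝ) : Prop :=
  ∀ x : Fin n → Plane, Function.Injective x → ∀ w : Query n → SignType, IsErrorRule x w →
    ENNReal.ofReal (1 - (n : ℝ) ^ (-c)) ≤ A.successProb p x w

end RandomizedAlgorithm

end NoisyCollinearity

namespace NoisyCollinearity

/-! On the curve `y = x ^ 3` the orientation determinant of three points is the Vandermonde product
of their abscissas times the sum of the abscissas, so collinearity of distinct points means that the
sum vanishes. This yields an input `x` without collinear triples and about `n ^ 2 / 16` inputs `y
τ`, each with a collinear triple, such that `y τ` is distinguished from `x` only by calls in a set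
`T τ`, and the sets `T τ` are disjoint (`exists_collapsible_configuration`).

On `x` the adversary always errs with `0`. On `y τ` it errs on `T τ` with the correct answer for
`x`, and with `0` elsewhere. Then a run on `x` becomes a run on `y τ` with the same answers once the
error bits of the calls in `T τ` are flipped. A flip changes the probability of an error pattern by
a factor of at most `R = (1 - p) / p`, whence `runLaw_outputs_le`: P_x(no) ≤ `R ^ m` P_y(no) +
P_x(more than `m` calls in `T τ`).

The left side is at least `1 - n ^ (-c)` and P_y(no) is at most `n ^ (-c)`. With `m` about `(c / 2)
log n / log R`, more than `m` calls hit `T τ` with probability at least `1 / 2`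
(`half_le_runLaw_callCount`). Markov's inequality, summed over the disjoint sets `T τ`, gives the
bound on the expected number of calls on `x`. -/

/-! ### Points on the cubic curve -/

/-- The point with abscissa `t` on the curve `y = x ^ 3`. -/
noncomputable def cubicPoint (t : ℤ) : Plane := !₂[(t : ℝ), (t : ℝ) ^ 3]

theorem sign_intCast_real (z : ℤ) : SignType.sign (z : ℝ) = SignType.sign z := by
  rcases lt_trichotomy z 0 with h | rfl | h
  · rw [sign_neg h, sign_neg (by exact_mod_cast h)]
  · simp
  · rw [sign_pos h, sign_pos (by exact_mod_cast h)]

theorem orientation_cubicPoint (a b c : ℤ) :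
    orientation (cubicPoint a) (cubicPoint b) (cubicPoint c) =
      SignType.sign (b - a) * SignType.sign (c - a) * SignType.sign (c - b) *
        SignType.sign (a + b + c) := by
  rw [← sign_mul, ← sign_mul, ← sign_mul, ← sign_intCast_real, orientation]
  congr 1
  simp [cubicPoint]
  ring

theorem cubicPoint_injective : Function.Injective cubicPoint := by
  intro a b h
  have := congrArg (fun v : Plane => v 0) h
  simpa [cubicPoint] using this

theorem orientation_eq_zero_of_collinear {a b c : Plane} (h : Collinear ℝ {a, b, c}) :
    orientation a b c = 0 := by
  rw [collinear_iff_of_mem (p₀ := a) (by simp)] at h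
  obtain ⟨v, hv⟩ := h
  obtain ⟨r, hr⟩ := hv b (by simp)
  obtain ⟨s, hs⟩ := hv c (by simp)
  rw [orientation, sign_eq_zero_iff, hr, hs]
  simp
  ring

theorem collinear_cubicPoint {a b c : ℤ} (hab : a ≠ b) (h : a + b + c = 0) :
    Collinear ℝ {cubicPoint a, cubicPoint b, cubicPoint c} := by
  have hab' : (b : ℝ) - a ≠ 0 := sub_ne_zero.2 (by exact_mod_cast hab.symm)
  have hc : (c : ℝ) = -a - b := by
    have : (a : ℝ) + b + c = 0 := by exact_mod_cast h
    linarith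
  rw [collinear_iff_of_mem (p₀ := cubicPoint a) (by simp)]
  refine ⟨cubicPoint b - cubicPoint a, ?_⟩
  intro p hp
  simp only [Set.mem_insert_iff, Set.mem_singleton_iff] at hp
  rcases hp with rfl | rfl | rfl
  · exact ⟨0, by simp⟩
  · exact ⟨1, by simp⟩
  · refine ⟨((c : ℝ) - a) / (b - a), ?_⟩
    ext i
    fin_cases i
    · simp [cubicPoint]
      field_simp
      ring
    · simp [cubicPoint, hc]
      field_simp
      ring

/-! ### A configuration with quadratically many collapsible triples -/

/-- Integers in three blocks such that a sum of three of them vanishes only if they are taken from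
the three different blocks, at positions `u`, `v` and `u + v`. -/
def blockBase (n m v : ℕ) : ℤ :=
  if v < m then 10 * n + v else if v < 2 * m then 30 * n + (v - m) else -(40 * n + (v - 2 * m))

/-- A perturbation of `blockBase` which breaks all the vanishing sums. -/
def genericShift (m v : ℕ) : ℤ := if v < m then 1 else 0

/-- A perturbation of `blockBase` which breaks all the vanishing sums, except the one at the
positions `i`, `j` and `i + j` of the three blocks. -/
def collapsingShift (m i j v : ℕ) : ℤ :=
  if v < m then 3 * ((v : ℤ) - i) ^ 2 else if v < 2 * m then 3 * ((v : ℤ) - m - j) ^ 2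
    else -((v : ℤ) - 2 * m - i - j) ^ 2

/-- The position `u` of the first block, `v` of the second one and `w` of the third one are such
that the corresponding values of `blockBase` add up to zero. -/
def BlockTriple (m u v w : ℕ) : Prop := u < m ∧ m ≤ v ∧ v < 2 * m ∧ u + v + m = w

/-- Among the sums of three of the leading coefficients `10`, `30`, `-40`, only `10 + 30 - 40`
vanishes. All others are at least `20` in absolute value, which the offsets, each less than `n`,
cannot compensate. -/
theorem blockTriple_of_sum_eq_zero {n m u v w : ℕ} (hmn : 4 * m ≤ n) (hu : u < n) (hv : v < n)
    (hw : w < n) (h : blockBase n m u + blockBase n m v + blockBase n m w = 0) :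
    BlockTriple m u v w ∨ BlockTriple m u w v ∨ BlockTriple m v u w ∨ BlockTriple m v w u ∨
      BlockTriple m w u v ∨ BlockTriple m w v u := by
  unfold blockBase at h
  unfold BlockTriple
  split_ifs at h <;> omega

theorem blockBase_injective {n m u v : ℕ} (hmn : 4 * m ≤ n) (hu : u < n) (hv : v < n)
    (h : blockBase n m u = blockBase n m v) : u = v := by
  unfold blockBase at h
  split_ifs at h <;> omega

theorem genericShift_add {m u v w : ℕ} (h : BlockTriple m u v w) :
    genericShift m u + genericShift m v + genericShift m w = 1 := by
  unfold BlockTriple at h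
  unfold genericShift
  split_ifs <;> omega

/-- With `a` and `b` the distances of the two positions from `i` and `j`, the shifts add up to `3a²
+ 3b² - (a + b)² = a² + b² + (a - b)²`, a positive definite form. The coefficient `2` in place of
`3` would leave only `(a - b)²`. -/
theorem collapsingShift_add {m u v w : ℕ} (i j : ℕ) (h : BlockTriple m u v w) :
    (0 < collapsingShift m i j u + collapsingShift m i j v + collapsingShift m i j w) ∨
    (u = i ∧ v = m + j ∧ w = 2 * m + i + j ∧
      collapsingShift m i j u + collapsingShift m i j v + collapsingShift m i j w = 0) := by
  obtain ⟨h1, h2, h3, rfl⟩ := h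
  have e1 : ¬ v < m := by omega
  have e2 : ¬ u + v + m < m := by omega
  have e3 : ¬ u + v + m < 2 * m := by omega
  simp only [collapsingShift, h1, e1, h3, e2, e3, if_true, if_false]
  by_cases hij : u = i ∧ v = m + j
  · right
    refine ⟨hij.1, hij.2, by omega, ?_⟩
    rw [hij.1, hij.2]
    push_cast
    ring
  · left
    obtain ⟨a, ha⟩ : ∃ a : ℤ, a = (u : ℤ) - i := ⟨_, rfl⟩
    obtain ⟨b, hb⟩ : ∃ b : ℤ, b = (v : ℤ) - m - j := ⟨_, rfl⟩
    have hab : a ≠ 0 ∨ b ≠ 0 := by omega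
    have : 3 * ((u : ℤ) - i) ^ 2 + 3 * ((v : ℤ) - m - j) ^ 2 +
        -(((u + v + m : ℕ) : ℤ) - 2 * m - i - j) ^ 2 = a ^ 2 + b ^ 2 + (a - b) ^ 2 := by
      rw [ha, hb]
      push_cast
      ring
    rw [this]
    rcases hab with h | h <;> positivity

theorem abs_genericShift_le {n m v : ℕ} (hv : v < n) : |genericShift m v| ≤ 3 * (n : ℤ) ^ 2 := by
  have : (1 : ℤ) ≤ n := by omega
  unfold genericShift
  split_ifs
  · rw [abs_one]; nlinarith
  · rw [abs_zero]; positivity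

theorem abs_collapsingShift_le {n m i j v : ℕ} (hmn : 4 * m ≤ n) (hi : i < m) (hj : j < m)
    (hv : v < n) : |collapsingShift m i j v| ≤ 3 * (n : ℤ) ^ 2 := by
  have key : ∀ a : ℤ, -n ≤ a → a ≤ n → a ^ 2 ≤ (n : ℤ) ^ 2 := fun a h1 h2 =>
    sq_le_sq' h1 h2
  unfold collapsingShift
  split_ifs
  · have := key ((v : ℤ) - i) (by omega) (by omega)
    rw [abs_of_nonneg (by positivity)]
    linarith
  · have := key ((v : ℤ) - m - j) (by omega) (by omega)
    rw [abs_of_nonneg (by positivity)]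
    linarith
  · have := key ((v : ℤ) - 2 * m - i - j) (by omega) (by omega)
    rw [abs_neg, abs_of_nonneg (by positivity)]
    nlinarith

/-- A large multiple of `blockBase`, perturbed by `f`. -/
def shiftedBase (n m : ℕ) (f : ℕ → ℤ) (v : ℕ) : ℤ := 100 * (n : ℤ) ^ 2 * blockBase n m v + f v

theorem sign_mul_add_eq {K d g : ℤ} (hd : d ≠ 0) (hg : |g| < K) :
    SignType.sign (K * d + g) = SignType.sign d := by
  rw [abs_lt] at hg
  rcases lt_or_gt_of_ne hd with h | h
  · rw [sign_neg h, sign_neg]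
    nlinarith
  · rw [sign_pos h, sign_pos]
    nlinarith

section

variable {n m : ℕ} {f : ℕ → ℤ} (hf : ∀ v < n, |f v| ≤ 3 * (n : ℤ) ^ 2)
include hf

/-- At most three shifts of size `3 * n ^ 2` are ever combined, so the multiplier `100 * n ^ 2` of a
nonzero integer dominates them. The order of the abscissas, and the sign of every sum with nonzero
base, are thus the same for all perturbations. -/
theorem sign_shiftedBase_sub (hmn : 4 * m ≤ n) {u v : ℕ} (hu : u < n) (hv : v < n) (huv : u ≠ v) :
    SignType.sign (shiftedBase n m f v - shiftedBase n m f u) =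
      SignType.sign (blockBase n m v - blockBase n m u) := by
  rw [← sign_mul_add_eq (K := 100 * (n : ℤ) ^ 2) (d := blockBase n m v - blockBase n m u)
    (g := f v - f u)]
  · unfold shiftedBase
    congr 1
    ring
  · exact sub_ne_zero.2 fun h => huv (blockBase_injective hmn hv hu h).symm
  · have h1 := hf u hu
    have h2 := hf v hv
    have : (0 : ℤ) < n := by omega
    have : (0 : ℤ) < (n : ℤ) ^ 2 := by positivity
    rw [abs_le] at h1 h2
    rw [abs_lt]
    constructor <;> linarith

theorem sign_shiftedBase_add {u v w : ℕ} (hu : u < n) (hv : v < n)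
    (hw : w < n) (h : blockBase n m u + blockBase n m v + blockBase n m w ≠ 0) :
    SignType.sign (shiftedBase n m f u + shiftedBase n m f v + shiftedBase n m f w) =
      SignType.sign (blockBase n m u + blockBase n m v + blockBase n m w) := by
  rw [← sign_mul_add_eq (K := 100 * (n : ℤ) ^ 2) (g := f u + f v + f w) h]
  · unfold shiftedBase
    congr 1
    ring
  · have h1 := hf u hu
    have h2 := hf v hv
    have h3 := hf w hw
    have : (0 : ℤ) < n := by omega
    have : (0 : ℤ) < (n : ℤ) ^ 2 := by positivity
    rw [abs_le] at h1 h2 h3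
    rw [abs_lt]
    constructor <;> linarith

theorem shiftedBase_injective (hmn : 4 * m ≤ n) :
    Function.Injective fun v : Fin n => shiftedBase n m f v := by
  intro u v h
  by_contra huv
  have huv' : (u : ℕ) ≠ v := fun h => huv (Fin.ext h)
  have := sign_shiftedBase_sub hf hmn u.2 v.2 huv'
  simp only at h
  rw [h, sub_self, sign_zero, eq_comm, sign_eq_zero_iff, sub_eq_zero] at this
  exact huv' (blockBase_injective hmn v.2 u.2 this).symm

end

theorem shiftedBase_add_of_sum_eq_zero {n m : ℕ} {f : ℕ → ℤ} {u v w : ℕ}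
    (h : blockBase n m u + blockBase n m v + blockBase n m w = 0) :
    shiftedBase n m f u + shiftedBase n m f v + shiftedBase n m f w = f u + f v + f w := by
  unfold shiftedBase
  linear_combination 100 * (n : ℤ) ^ 2 * h

theorem shiftedBase_genericShift_add_pos {n m u v w : ℕ} (hmn : 4 * m ≤ n) (hu : u < n)
    (hv : v < n) (hw : w < n) (h : blockBase n m u + blockBase n m v + blockBase n m w = 0) :
    0 < shiftedBase n m (genericShift m) u + shiftedBase n m (genericShift m) v +
      shiftedBase n m (genericShift m) w := by
  rw [shiftedBase_add_of_sum_eq_zero h]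
  rcases blockTriple_of_sum_eq_zero hmn hu hv hw h with h | h | h | h | h | h <;>
    linarith [genericShift_add h]

theorem shiftedBase_collapsingShift_add {n m u v w : ℕ} (i j : ℕ) (hmn : 4 * m ≤ n) (hu : u < n)
    (hv : v < n) (hw : w < n) (h : blockBase n m u + blockBase n m v + blockBase n m w = 0) :
    (0 < shiftedBase n m (collapsingShift m i j) u + shiftedBase n m (collapsingShift m i j) v +
      shiftedBase n m (collapsingShift m i j) w) ∨
    (shiftedBase n m (collapsingShift m i j) u + shiftedBase n m (collapsingShift m i j) v +
      shiftedBase n m (collapsingShift m i j) w = 0 ∧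
      (({u, v, w} : Finset ℕ) = {i, m + j, 2 * m + i + j})) := by
  rw [shiftedBase_add_of_sum_eq_zero h]
  rcases blockTriple_of_sum_eq_zero hmn hu hv hw h with h | h | h | h | h | h <;>
  rcases collapsingShift_add i j h with h | ⟨rfl, rfl, rfl, h⟩
  all_goals first
    | (left; linarith)
    | (right; refine ⟨by linarith, ?_⟩; ext; simp only [Finset.mem_insert, Finset.mem_singleton] <;> omega)

/-- There is an input of `n` points without collinear triples, and a quadratic number of inputs
with a collinear triple, such that the correct answers for each of the latter inputs differ from
those for the former one only on a set of calls, and these sets of calls are disjoint. -/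
theorem exists_collapsible_configuration {n m : ℕ} (hmn : 4 * m ≤ n) :
    ∃ (x : Fin n → Plane) (y : Fin m × Fin m → Fin n → Plane) (T : Fin m × Fin m → Set (Query n)),
      Function.Injective x ∧ ¬ HasCollinearTriple x ∧ (∀ q, trueAnswer x q ≠ 0) ∧
      (∀ τ, Function.Injective (y τ)) ∧ (∀ τ, HasCollinearTriple (y τ)) ∧
      (∀ τ, ∀ q ∈ T τ, trueAnswer (y τ) q = 0) ∧
      (∀ τ, ∀ q ∉ T τ, trueAnswer (y τ) q = trueAnswer x q) ∧
      Pairwise (fun σ τ => Disjoint (T σ) (T τ)) := by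
  have hg : ∀ v < n, |genericShift m v| ≤ 3 * (n : ℤ) ^ 2 := fun v hv => abs_genericShift_le hv
  have hc : ∀ τ : Fin m × Fin m, ∀ v < n, |collapsingShift m τ.1 τ.2 v| ≤ 3 * (n : ℤ) ^ 2 :=
    fun τ v hv => abs_collapsingShift_le hmn τ.1.2 τ.2.2 hv
  have hneq : ∀ (q : Query n) (a b : Fin 3), a ≠ b → (q a : ℕ) ≠ q b := fun q a b hab h =>
    hab (q.injective (Fin.ext h))
  have hx0 : ∀ q : Query n,
      trueAnswer (fun v => cubicPoint (shiftedBase n m (genericShift m) v)) q ≠ 0 := by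
    intro q
    have hne : ∀ a b : Fin 3, a ≠ b → SignType.sign (shiftedBase n m (genericShift m) (q a) -
        shiftedBase n m (genericShift m) (q b)) ≠ 0 := by
      intro a b hab
      rw [Ne, sign_eq_zero_iff, sub_eq_zero]
      exact fun h => hab (q.injective (shiftedBase_injective hg hmn h))
    rw [trueAnswer, orientation_cubicPoint]
    refine mul_ne_zero (mul_ne_zero (mul_ne_zero ?_ ?_) ?_) ?_
    · exact hne _ _ (by decide)
    · exact hne _ _ (by decide)
    · exact hne _ _ (by decide)
    · by_cases h : blockBase n m (q 0) + blockBase n m (q 1) + blockBase n m (q 2) = 0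
      · rw [sign_pos (shiftedBase_genericShift_add_pos hmn (q 0).2 (q 1).2 (q 2).2 h)]
        decide
      · rw [sign_shiftedBase_add hg (q 0).2 (q 1).2 (q 2).2 h]
        rwa [Ne, sign_eq_zero_iff]
  refine ⟨fun v => cubicPoint (shiftedBase n m (genericShift m) v),
    fun τ v => cubicPoint (shiftedBase n m (collapsingShift m τ.1 τ.2) v),
    fun τ => {q | shiftedBase n m (collapsingShift m τ.1 τ.2) (q 0) +
      shiftedBase n m (collapsingShift m τ.1 τ.2) (q 1) +
      shiftedBase n m (collapsingShift m τ.1 τ.2) (q 2) = 0}, ?_, ?_, hx0, ?_, ?_, ?_, ?_, ?_⟩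
  · exact cubicPoint_injective.comp (shiftedBase_injective hg hmn)
  · rintro ⟨i, j, k, hij, hik, hjk, h⟩
    have hinj : Function.Injective ![i, j, k] := by
      intro a b hab
      fin_cases a <;> fin_cases b <;> simp_all
    exact hx0 ⟨![i, j, k], hinj⟩ (orientation_eq_zero_of_collinear h)
  · exact fun τ => cubicPoint_injective.comp (shiftedBase_injective (hc τ) hmn)
  · intro τ
    have h1 := τ.1.2
    have h2 := τ.2.2
    refine ⟨⟨τ.1, by omega⟩, ⟨m + τ.2, by omega⟩, ⟨2 * m + τ.1 + τ.2, by omega⟩, ?_, ?_, ?_, ?_⟩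
    · rw [Ne, Fin.mk.injEq]; omega
    · rw [Ne, Fin.mk.injEq]; omega
    · rw [Ne, Fin.mk.injEq]; omega
    · apply collinear_cubicPoint
      · intro h
        have := shiftedBase_injective (hc τ) hmn (a₁ := ⟨τ.1, by omega⟩)
          (a₂ := ⟨m + τ.2, by omega⟩) h
        rw [Fin.mk.injEq] at this
        omega
      · have e2 : ¬ m + (τ.2 : ℕ) < m := by omega
        have e3 : m + (τ.2 : ℕ) < 2 * m := by omega
        have e4 : ¬ 2 * m + (τ.1 : ℕ) + τ.2 < m := by omega
        have e5 : ¬ 2 * m + (τ.1 : ℕ) + τ.2 < 2 * m := by omega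
        simp only [shiftedBase, blockBase, collapsingShift, h1, e2, e3, e4, e5, if_true, if_false]
        push_cast
        ring
  · intro τ q hq
    rw [trueAnswer, orientation_cubicPoint]
    simp only [Set.mem_ofPred_eq] at hq
    rw [hq, sign_zero, mul_zero]
  · intro τ q hq
    simp only [Set.mem_ofPred_eq] at hq
    rw [trueAnswer, trueAnswer, orientation_cubicPoint, orientation_cubicPoint]
    have h01 := hneq q 0 1 (by decide)
    have h02 := hneq q 0 2 (by decide)
    have h12 := hneq q 1 2 (by decide)
    rw [sign_shiftedBase_sub hg hmn (q 0).2 (q 1).2 h01,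
      sign_shiftedBase_sub hg hmn (q 0).2 (q 2).2 h02,
      sign_shiftedBase_sub hg hmn (q 1).2 (q 2).2 h12,
      sign_shiftedBase_sub (hc τ) hmn (q 0).2 (q 1).2 h01,
      sign_shiftedBase_sub (hc τ) hmn (q 0).2 (q 2).2 h02,
      sign_shiftedBase_sub (hc τ) hmn (q 1).2 (q 2).2 h12]
    -- The Vandermonde factors agree. In the remaining factor, vanishing base sums are perturbed to
    -- positive values on both inputs, except on the collapsed triple.
    congr 1
    by_cases h : blockBase n m (q 0) + blockBase n m (q 1) + blockBase n m (q 2) = 0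
    · rw [sign_pos (shiftedBase_genericShift_add_pos hmn (q 0).2 (q 1).2 (q 2).2 h)]
      rcases shiftedBase_collapsingShift_add τ.1 τ.2 hmn (q 0).2 (q 1).2 (q 2).2 h with h | h
      · rw [sign_pos h]
      · exact absurd h.1 hq
    · rw [sign_shiftedBase_add hg (q 0).2 (q 1).2 (q 2).2 h,
        sign_shiftedBase_add (hc τ) (q 0).2 (q 1).2 (q 2).2 h]
  · intro σ τ hστ
    rw [Set.disjoint_left]
    intro q hσ hτ
    have key : ∀ τ : Fin m × Fin m, shiftedBase n m (collapsingShift m τ.1 τ.2) (q 0) +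
        shiftedBase n m (collapsingShift m τ.1 τ.2) (q 1) +
        shiftedBase n m (collapsingShift m τ.1 τ.2) (q 2) = 0 →
        ({(q 0 : ℕ), (q 1 : ℕ), (q 2 : ℕ)} : Finset ℕ) =
          {(τ.1 : ℕ), m + τ.2, 2 * m + τ.1 + τ.2} := by
      intro τ h
      by_cases hb : blockBase n m (q 0) + blockBase n m (q 1) + blockBase n m (q 2) = 0
      · rcases shiftedBase_collapsingShift_add τ.1 τ.2 hmn (q 0).2 (q 1).2 (q 2).2 hb with h' | h'
        · omega
        · exact h'.2
      · have := sign_shiftedBase_add (hc τ) (q 0).2 (q 1).2 (q 2).2 hb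
        rw [h, sign_zero, eq_comm, sign_eq_zero_iff] at this
        exact absurd this hb
    have e := (key σ hσ).symm.trans (key τ hτ)
    have h1 := σ.1.2
    have h2 := τ.1.2
    have h3 := σ.2.2
    have h4 := τ.2.2
    -- The three positions lie in `[0, m)`, `[m, 2m)` and `[2m, n)`, so the unordered triple
    -- determines both indices.
    have m1 : (σ.1 : ℕ) ∈ ({(τ.1 : ℕ), m + τ.2, 2 * m + τ.1 + τ.2} : Finset ℕ) := by
      rw [← e]; simp
    have m2 : m + (σ.2 : ℕ) ∈ ({(τ.1 : ℕ), m + τ.2, 2 * m + τ.1 + τ.2} : Finset ℕ) := by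
      rw [← e]; simp
    simp only [Finset.mem_insert, Finset.mem_singleton] at m1 m2
    exact hστ (Prod.ext (Fin.ext (by omega)) (Fin.ext (by omega)))

/-! ### Events that depend on finitely many coordinates -/

/-- The extension by `false` of a finite sequence. -/
def extendFalse {k : ℕ} (v : Fin k → Bool) (i : ℕ) : Bool := if h : i < k then v ⟨i, h⟩ else false

theorem extendFalse_apply {k : ℕ} (v : Fin k → Bool) (i : Fin k) : extendFalse v i = v i := by
  simp [extendFalse]

open Classical in
theorem infinitePi_eq_sum (μ : Measure Bool) [IsProbabilityMeasure μ] {k : ℕ}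
    {S : Set (ℕ → Bool)} (hS : ∀ e e' : ℕ → Bool, (∀ i < k, e i = e' i) → e ∈ S → e' ∈ S) :
    Measure.infinitePi (fun _ : ℕ => μ) S =
      ∑ v : Fin k → Bool, if extendFalse v ∈ S then ∏ i, μ {v i} else 0 := by
  have hbox : ∀ v : Fin k → Bool, Measure.infinitePi (fun _ : ℕ => μ)
      (Set.pi (Finset.range k) fun i => {extendFalse v i}) = ∏ i, μ {v i} := by
    intro v
    rw [Measure.infinitePi_pi _ (fun _ _ => measurableSet_singleton _), Finset.prod_range]
    simp only [extendFalse_apply]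
  have hSU : S = ⋃ v ∈ Finset.univ.filter (fun v : Fin k → Bool => extendFalse v ∈ S),
      Set.pi (Finset.range k) fun i => {extendFalse v i} := by
    ext e
    simp only [Set.mem_iUnion, Finset.mem_filter, Finset.mem_univ, true_and, Set.mem_pi,
      Finset.coe_range, Set.mem_Iio, Set.mem_singleton_iff, exists_prop]
    constructor
    · intro he
      have : ∀ i < k, e i = extendFalse (fun i : Fin k => e i) i := by
        intro i hi
        simp [extendFalse, hi]
      exact ⟨fun i => e i, hS _ _ this he, this⟩
    · rintro ⟨v, hv, h⟩
      exact hS _ _ (fun i hi => (h i hi).symm) hv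
  conv_lhs => rw [hSU]
  rw [measure_biUnion_finset, Finset.sum_filter]
  · simp only [hbox]
  · intro v _ v' _ hvv'
    refine Set.disjoint_left.2 fun e he he' => hvv' (funext fun i => ?_)
    have h1 := he i (by simp)
    have h2 := he' i (by simp)
    simp only [Set.mem_singleton_iff, extendFalse_apply] at h1 h2
    rw [← h1, h2]
  · intro v _
    exact MeasurableSet.pi (Finset.countable_toSet _) fun _ _ => measurableSet_singleton _

/-- A change of variables on the finite cube: an injective self-map is a permutation, so the sum for
`S'` can be reindexed along `Φ` and compared term by term. The padding by `false` is harmless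
because the events ignore coordinates from `k` on. -/
theorem infinitePi_le_mul_of_injective (μ : Measure Bool) [IsProbabilityMeasure μ] {k : ℕ}
    {S S' : Set (ℕ → Bool)} (hS : ∀ e e' : ℕ → Bool, (∀ i < k, e i = e' i) → e ∈ S → e' ∈ S)
    (hS' : ∀ e e' : ℕ → Bool, (∀ i < k, e i = e' i) → e ∈ S' → e' ∈ S')
    {Φ : (Fin k → Bool) → Fin k → Bool} (hΦ : Function.Injective Φ) (c : ℝ≥0∞)
    (hmem : ∀ v, extendFalse v ∈ S → extendFalse (Φ v) ∈ S')
    (hle : ∀ v, extendFalse v ∈ S → ∏ i, μ {v i} ≤ c * ∏ i, μ {Φ v i}) :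
    Measure.infinitePi (fun _ : ℕ => μ) S ≤ c * Measure.infinitePi (fun _ : ℕ => μ) S' := by
  classical
  rw [infinitePi_eq_sum μ hS, infinitePi_eq_sum μ hS',
    ← (Finite.injective_iff_bijective.1 hΦ).sum_comp fun u : Fin k → Bool =>
      if extendFalse u ∈ S' then ∏ i, μ {u i} else 0, Finset.mul_sum]
  refine Finset.sum_le_sum fun v _ => ?_
  split_ifs with h1 h2 h2
  · exact hle v h1
  · exact absurd (hmem v h1) h2
  · exact zero_le
  · exact zero_le

namespace RandomizedAlgorithm

variable {n : ℕ} (A : RandomizedAlgorithm.{u} n)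

/-! ### Basic properties of runs -/

theorem answers_congr (x : Fin n → Plane) (w : Query n → SignType) (s : A.Seed)
    {e e' : ℕ → Bool} {k : ℕ} (h : ∀ i < k, e i = e' i) :
    A.answers x w s e k = A.answers x w s e' k := by
  induction k with
  | zero => rfl
  | succ k ih =>
    rw [answers, answers, ih fun i hi => h i (by omega), h k (by omega)]

theorem answers_succ_of_halted {x : Fin n → Plane} {w : Query n → SignType} {s : A.Seed}
    {e : ℕ → Bool} {k : ℕ} {b : Bool} (h : A.next s (A.answers x w s e k) = Sum.inr b) :
    A.answers x w s e (k + 1) = A.answers x w s e k := by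
  rw [answers, h]

theorem answers_succ_of_call {x : Fin n → Plane} {w : Query n → SignType} {s : A.Seed}
    {e : ℕ → Bool} {k : ℕ} {q : Query n} (h : A.next s (A.answers x w s e k) = Sum.inl q) :
    A.answers x w s e (k + 1) = A.answers x w s e k ++ [noisyAnswer x w q (e k)] := by
  rw [answers, h]

theorem answers_of_halted_of_le {x : Fin n → Plane} {w : Query n → SignType} {s : A.Seed}
    {e : ℕ → Bool} {k l : ℕ} {b : Bool} (h : A.next s (A.answers x w s e k) = Sum.inr b)
    (hkl : k ≤ l) : A.answers x w s e l = A.answers x w s e k := by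
  induction l, hkl using Nat.le_induction with
  | base => rfl
  | succ l _ ih => rw [A.answers_succ_of_halted (b := b) (by rw [ih, h]), ih]

theorem outputs_unique {x : Fin n → Plane} {w : Query n → SignType} {s : A.Seed}
    {e : ℕ → Bool} {b b' : Bool} (h : A.Outputs x w s e b) (h' : A.Outputs x w s e b') :
    b = b' := by
  obtain ⟨k, hk⟩ := h
  obtain ⟨l, hl⟩ := h'
  rcases le_total k l with hkl | hkl
  · rw [A.answers_of_halted_of_le hk hkl, hk] at hl
    exact Sum.inr_injective hl
  · rw [A.answers_of_halted_of_le hl hkl, hl] at hk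
    exact (Sum.inr_injective hk).symm

/-- The `i`-th step of the run is a call in the set `T`. -/
def CallsAt (T : Set (Query n)) (x : Fin n → Plane) (w : Query n → SignType)
    (s : A.Seed) (e : ℕ → Bool) (i : ℕ) : Prop :=
  ∃ q ∈ T, A.next s (A.answers x w s e i) = Sum.inl q

open Classical in
/-- The number of calls in the set `T` during the first `k` steps of the run. -/
noncomputable def callCount (T : Set (Query n)) (x : Fin n → Plane) (w : Query n → SignType)
    (s : A.Seed) (e : ℕ → Bool) (k : ℕ) : ℕ :=
  ∑ i ∈ Finset.range k, if A.CallsAt T x w s e i then 1 else 0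

theorem callCount_mono (T : Set (Query n)) (x : Fin n → Plane) (w : Query n → SignType)
    (s : A.Seed) (e : ℕ → Bool) : Monotone (A.callCount T x w s e) := by
  intro k l hkl
  exact Finset.sum_le_sum_of_subset (Finset.range_mono hkl)

theorem callCount_succ_of_halted {T : Set (Query n)} {x : Fin n → Plane} {w : Query n → SignType}
    {s : A.Seed} {e : ℕ → Bool} {k : ℕ} {b : Bool}
    (h : A.next s (A.answers x w s e k) = Sum.inr b) :
    A.callCount T x w s e (k + 1) = A.callCount T x w s e k := by
  rw [callCount, Finset.sum_range_succ, if_neg, add_zero, callCount]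
  rintro ⟨q, _, hq⟩
  simp [h] at hq

theorem callCount_congr (T : Set (Query n)) (x : Fin n → Plane) (w : Query n → SignType)
    (s : A.Seed) {e e' : ℕ → Bool} {k : ℕ} (h : ∀ i < k, e i = e' i) :
    A.callCount T x w s e k = A.callCount T x w s e' k := by
  classical
  unfold callCount
  refine Finset.sum_congr rfl fun i hi => ?_
  rw [Finset.mem_range] at hi
  have : A.CallsAt T x w s e i ↔ A.CallsAt T x w s e' i := by
    rw [CallsAt, CallsAt, A.answers_congr x w s fun j hj => h j (hj.trans hi)]
  exact if_congr this rfl rfl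

/-- By disjointness each call is counted for at most one index. -/
theorem sum_callCount_le {ι : Type*} [Fintype ι] {T : ι → Set (Query n)}
    (hT : Pairwise fun σ τ => Disjoint (T σ) (T τ)) (x : Fin n → Plane) (w : Query n → SignType)
    (s : A.Seed) (e : ℕ → Bool) (k : ℕ) :
    ∑ τ, A.callCount (T τ) x w s e k ≤ (A.answers x w s e k).length := by
  classical
  induction k with
  | zero => simp [callCount]
  | succ k ih =>
    cases h : A.next s (A.answers x w s e k) with
    | inr b =>
      simp only [A.callCount_succ_of_halted h, A.answers_succ_of_halted h]
      exact ih
    | inl q =>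
      simp only [A.answers_succ_of_call h, List.length_append, List.length_singleton]
      simp only [callCount, Finset.sum_range_succ, Finset.sum_add_distrib] at ih ⊢
      refine add_le_add ih ?_
      rw [Finset.sum_boole, Nat.cast_id, Finset.card_le_one]
      intro σ hσ τ hτ
      simp only [Finset.mem_filter, CallsAt, h, Sum.inl.injEq] at hσ hτ
      obtain ⟨_, q1, h1, rfl⟩ := hσ
      obtain ⟨_, q2, h2, rfl⟩ := hτ
      by_contra hne
      exact Set.disjoint_left.1 (hT hne) h1 h2

/-! ### Measurability -/

/-- There are only countably many answer lists, so conditioning on the list reduces measurability to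
`measurableSet_next` for a fixed history. -/
theorem measurableSet_answers (x : Fin n → Plane) (w : Query n → SignType) (k : ℕ)
    (h : List SignType) :
    MeasurableSet {r : A.Seed × (ℕ → Bool) | A.answers x w r.1 r.2 k = h} := by
  induction k generalizing h with
  | zero =>
    simp only [answers]
    exact MeasurableSet.const _
  | succ k ih =>
    have : {r : A.Seed × (ℕ → Bool) | A.answers x w r.1 r.2 (k + 1) = h} =
        (⋃ h' : List SignType, ⋃ q : Query n, ⋃ b : Bool,
          {r | A.answers x w r.1 r.2 k = h'} ∩ {r | A.next r.1 h' = Sum.inl q} ∩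
            {r | r.2 k = b} ∩ {_r | h' ++ [noisyAnswer x w q b] = h}) ∪
        ⋃ b : Bool, {r | A.answers x w r.1 r.2 k = h} ∩ {r | A.next r.1 h = Sum.inr b} := by
      ext r
      simp only [Set.mem_ofPred_eq, Set.mem_union, Set.mem_iUnion, Set.mem_inter_iff]
      cases hr : A.next r.1 (A.answers x w r.1 r.2 k) with
      | inl q =>
        rw [A.answers_succ_of_call hr]
        constructor
        · intro h1
          exact Or.inl ⟨_, q, _, ⟨⟨rfl, hr⟩, rfl⟩, h1⟩
        · rintro (⟨h', q', b, ⟨⟨rfl, h2⟩, rfl⟩, h3⟩ | ⟨b, rfl, h2⟩)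
          · rw [hr, Sum.inl.injEq] at h2
            rw [h2, h3]
          · rw [hr] at h2; cases h2
      | inr b =>
        rw [A.answers_succ_of_halted hr]
        constructor
        · rintro rfl
          exact Or.inr ⟨b, rfl, hr⟩
        · rintro (⟨h', q', b, ⟨⟨rfl, h2⟩, rfl⟩, h3⟩ | ⟨b, rfl, h2⟩)
          · rw [hr] at h2; cases h2
          · rfl
    rw [this]
    refine MeasurableSet.union ?_ ?_
    · refine MeasurableSet.iUnion fun h' => MeasurableSet.iUnion fun q => MeasurableSet.iUnion
        fun b => (((ih h').inter ?_).inter ?_).inter (MeasurableSet.const _)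
      · exact measurable_fst (A.measurableSet_next h' (Sum.inl q))
      · have hk : Measurable fun r : A.Seed × (ℕ → Bool) => r.2 k :=
          (measurable_pi_apply k).comp measurable_snd
        exact hk (measurableSet_singleton b)
    · exact MeasurableSet.iUnion fun b => (ih h).inter
        (measurable_fst (A.measurableSet_next h (Sum.inr b)))

theorem measurableSet_next_answers (x : Fin n → Plane) (w : Query n → SignType) (k : ℕ)
    (a : Query n ⊕ Bool) :
    MeasurableSet {r : A.Seed × (ℕ → Bool) | A.next r.1 (A.answers x w r.1 r.2 k) = a} := by
  have : {r : A.Seed × (ℕ → Bool) | A.next r.1 (A.answers x w r.1 r.2 k) = a} =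
      ⋃ h : List SignType, {r | A.answers x w r.1 r.2 k = h} ∩ {r | A.next r.1 h = a} := by
    ext r
    simp
  rw [this]
  exact MeasurableSet.iUnion fun h => (A.measurableSet_answers x w k h).inter
    (measurable_fst (A.measurableSet_next h a))

theorem measurableSet_outputs (x : Fin n → Plane) (w : Query n → SignType) (b : Bool) :
    MeasurableSet {r : A.Seed × (ℕ → Bool) | A.Outputs x w r.1 r.2 b} := by
  simp only [Outputs, Set.ofPred_exists]
  exact MeasurableSet.iUnion fun k => A.measurableSet_next_answers x w k _

theorem measurable_callCount (T : Set (Query n)) (x : Fin n → Plane) (w : Query n → SignType)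
    (k : ℕ) : Measurable fun r : A.Seed × (ℕ → Bool) => A.callCount T x w r.1 r.2 k := by
  unfold callCount
  refine Finset.measurable_sum _ fun i _ => Measurable.ite ?_ measurable_const measurable_const
  simp only [CallsAt, Set.ofPred_exists, Set.ofPred_and]
  exact MeasurableSet.iUnion fun q => (MeasurableSet.const _).inter
    (A.measurableSet_next_answers x w i _)

/-! ### Comparison of the runs on two inputs -/

open Classical in
/-- The error pattern which differs from `e` exactly at the calls in the set `T`. -/
noncomputable def flipErrors (T : Set (Query n)) (x : Fin n → Plane) (w : Query n → SignType)
    (s : A.Seed) (e : ℕ → Bool) (i : ℕ) : Bool :=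
  if A.CallsAt T x w s e i then !e i else e i

section Compare

variable {T : Set (Query n)} {x y : Fin n → Plane} {w w' : Query n → SignType}

/-- The coupling of the two runs. Inductively the histories coincide, so both runs make the same
next call, and flipping its error bit exactly when it lies in `T` makes the answers coincide too. -/
theorem answers_flipErrors
    (hmem : ∀ q ∈ T, ∀ b, noisyAnswer y w' q (!b) = noisyAnswer x w q b)
    (hnmem : ∀ q ∉ T, ∀ b, noisyAnswer y w' q b = noisyAnswer x w q b)
    (s : A.Seed) (e : ℕ → Bool) (k : ℕ) :
    A.answers y w' s (A.flipErrors T x w s e) k = A.answers x w s e k := by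
  induction k with
  | zero => rfl
  | succ k ih =>
    cases h : A.next s (A.answers x w s e k) with
    | inr b => rw [A.answers_succ_of_halted h, A.answers_succ_of_halted (by rw [ih, h]), ih]
    | inl q =>
      rw [A.answers_succ_of_call h, A.answers_succ_of_call (by rw [ih, h]), ih]
      by_cases hq : q ∈ T
      · rw [flipErrors, if_pos ⟨q, hq, h⟩, hmem q hq]
      · rw [flipErrors, if_neg, hnmem q hq]
        rintro ⟨q', hq', h'⟩
        rw [h, Sum.inl.injEq] at h'
        exact hq (h' ▸ hq')

/-- Fixing the step `k` leaves finitely many error bits, on which the flip is a permutation. Each of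
the at most `m` flipped bits costs a factor `R`. -/
theorem infinitePi_halted_le
    (hmem : ∀ q ∈ T, ∀ b, noisyAnswer y w' q (!b) = noisyAnswer x w q b)
    (hnmem : ∀ q ∉ T, ∀ b, noisyAnswer y w' q b = noisyAnswer x w q b)
    (μ : Measure Bool) [IsProbabilityMeasure μ] {R : ℝ≥0∞} (hR : 1 ≤ R)
    (hμ : ∀ b, μ {b} ≤ R * μ {!b}) (s : A.Seed) (b : Bool) (k m : ℕ) :
    Measure.infinitePi (fun _ : ℕ => μ) {e | A.next s (A.answers x w s e k) = Sum.inr b ∧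
        A.callCount T x w s e k ≤ m} ≤
      R ^ m * Measure.infinitePi (fun _ : ℕ => μ)
        {e | A.next s (A.answers y w' s e k) = Sum.inr b} := by
  classical
  have hext : ∀ v : Fin k → Bool, ∀ i < k,
      extendFalse (fun i : Fin k => A.flipErrors T x w s (extendFalse v) i) i =
        A.flipErrors T x w s (extendFalse v) i := by
    intro v i hi
    simp [extendFalse, hi]
  have hans : ∀ v : Fin k → Bool, ∀ i ≤ k, A.answers y w' s
      (extendFalse (fun i : Fin k => A.flipErrors T x w s (extendFalse v) i)) i =
        A.answers x w s (extendFalse v) i := by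
    intro v i hi
    rw [A.answers_congr y w' s fun j hj => hext v j (by omega), A.answers_flipErrors hmem hnmem]
  refine infinitePi_le_mul_of_injective μ (k := k)
    (Φ := fun v i => A.flipErrors T x w s (extendFalse v) i) ?_ ?_ ?_ _ ?_ ?_
  · intro e e' h
    simp only [Set.mem_ofPred_eq, A.answers_congr x w s h, A.callCount_congr T x w s h]
    exact id
  · intro e e' h
    simp only [Set.mem_ofPred_eq, A.answers_congr y w' s h]
    exact id
  · intro v v' hv
    simp only at hv
    funext i
    have h1 := congrFun hv i
    -- Injectivity: the flipped pattern determines the run on `y`, hence the history on `x`, hence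
    -- which bits were flipped.
    have h2 : A.answers x w s (extendFalse v) i = A.answers x w s (extendFalse v') i := by
      rw [← hans v i i.2.le, ← hans v' i i.2.le, hv]
    simp only [flipErrors, CallsAt, h2, extendFalse_apply] at h1
    split_ifs at h1 with h3
    · simpa using h1
    · exact h1
  · intro v hv
    simp only [Set.mem_ofPred_eq] at hv ⊢
    rw [hans v k le_rfl]
    exact hv.1
  · rintro v ⟨-, hv⟩
    calc ∏ i, μ {v i} ≤ ∏ i : Fin k,
          (R ^ (if A.CallsAt T x w s (extendFalse v) i then 1 else 0) *
            μ {A.flipErrors T x w s (extendFalse v) i}) := by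
          refine Finset.prod_le_prod' fun i _ => ?_
          rw [flipErrors, extendFalse_apply]
          split_ifs
          · rw [pow_one]
            exact hμ _
          · rw [pow_zero, one_mul]
      _ = R ^ A.callCount T x w s (extendFalse v) k *
            ∏ i : Fin k, μ {A.flipErrors T x w s (extendFalse v) i} := by
          rw [Finset.prod_mul_distrib, Finset.prod_pow_eq_pow_sum, callCount, Finset.sum_range]
      _ ≤ _ := by
          gcongr

theorem runLaw_outputs_le
    (hmem : ∀ q ∈ T, ∀ b, noisyAnswer y w' q (!b) = noisyAnswer x w q b)
    (hnmem : ∀ q ∉ T, ∀ b, noisyAnswer y w' q b = noisyAnswer x w q b)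
    (p : unitInterval) {R : ℝ≥0∞} (hR : 1 ≤ R)
    (hp : ∀ b, bernoulliMeasure true false p {b} ≤ R * bernoulliMeasure true false p {!b})
    (b : Bool) (m : ℕ) :
    A.runLaw p {r | A.Outputs x w r.1 r.2 b} ≤
      R ^ m * A.runLaw p {r | A.Outputs y w' r.1 r.2 b} +
        A.runLaw p {r | ∃ k, m + 1 ≤ A.callCount T x w r.1 r.2 k} := by
  set S : ℕ → Set (A.Seed × (ℕ → Bool)) := fun k =>
    {r | A.next r.1 (A.answers x w r.1 r.2 k) = Sum.inr b ∧ A.callCount T x w r.1 r.2 k ≤ m}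
    with hSdef
  have hSmeas : ∀ k, MeasurableSet (S k) := fun k =>
    (A.measurableSet_next_answers x w k _).inter
      (A.measurable_callCount T x w k measurableSet_Iic)
  -- After halting, neither the answers nor the counts change, so continuity from below passes from
  -- a fixed step to the event of eventual output.
  have hSmono : Monotone S := by
    refine monotone_nat_of_le_succ fun k r hr => ?_
    simp only [hSdef, Set.mem_ofPred_eq] at hr ⊢
    rw [A.answers_succ_of_halted hr.1, A.callCount_succ_of_halted hr.1]
    exact hr
  have hsub : {r : A.Seed × (ℕ → Bool) | A.Outputs x w r.1 r.2 b} ⊆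
      (⋃ k, S k) ∪ {r | ∃ k, m + 1 ≤ A.callCount T x w r.1 r.2 k} := by
    rintro r ⟨k, hk⟩
    by_cases h : A.callCount T x w r.1 r.2 k ≤ m
    · exact Or.inl (Set.mem_iUnion.2 ⟨k, hk, h⟩)
    · exact Or.inr ⟨k, by omega⟩
  refine (measure_mono hsub).trans ((measure_union_le _ _).trans ?_)
  gcongr
  rw [hSmono.measure_iUnion]
  refine iSup_le fun k => ?_
  calc A.runLaw p (S k)
      ≤ R ^ m * A.runLaw p {r | A.next r.1 (A.answers y w' r.1 r.2 k) = Sum.inr b} := by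
        rw [runLaw, Measure.prod_apply (hSmeas k),
          Measure.prod_apply (A.measurableSet_next_answers y w' k _), ← lintegral_const_mul]
        · exact lintegral_mono fun s =>
            A.infinitePi_halted_le hmem hnmem _ hR hp s b k m
        · exact measurable_measure_prodMk_left (A.measurableSet_next_answers y w' k _)
    _ ≤ R ^ m * A.runLaw p {r | A.Outputs y w' r.1 r.2 b} := by
        gcongr _ * A.runLaw p ?_
        intro r hr
        exact ⟨k, hr⟩

end Compare

/-- Markov's inequality for each index. Monotonicity in the step then allows the finite sum and the
supremum to be exchanged before disjointness is applied. -/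
theorem sum_measure_callCount_le_expectedCalls {ι : Type*} [Fintype ι] {T : ι → Set (Query n)}
    (hT : Pairwise fun σ τ => Disjoint (T σ) (T τ)) (p : unitInterval) (x : Fin n → Plane)
    (w : Query n → SignType) (m : ℕ) :
    ∑ τ, (m : ℝ≥0∞) * A.runLaw p {r | ∃ k, m ≤ A.callCount (T τ) x w r.1 r.2 k} ≤
      A.expectedCalls p x w := by
  have hmeas : ∀ τ, Measurable fun r : A.Seed × (ℕ → Bool) =>
      ⨆ k, (A.callCount (T τ) x w r.1 r.2 k : ℝ≥0∞) := fun τ =>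
    Measurable.iSup fun k => measurable_from_top.comp (A.measurable_callCount (T τ) x w k)
  calc ∑ τ, (m : ℝ≥0∞) * A.runLaw p {r | ∃ k, m ≤ A.callCount (T τ) x w r.1 r.2 k}
      ≤ ∑ τ, ∫⁻ r, ⨆ k, (A.callCount (T τ) x w r.1 r.2 k : ℝ≥0∞) ∂(A.runLaw p) := by
        refine Finset.sum_le_sum fun τ _ =>
          le_trans ?_ (mul_meas_ge_le_lintegral (hmeas τ) (m : ℝ≥0∞))
        gcongr
        rintro ⟨k, hk⟩
        exact le_iSup_of_le k (by exact_mod_cast hk)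
    _ = ∫⁻ r, ∑ τ, ⨆ k, (A.callCount (T τ) x w r.1 r.2 k : ℝ≥0∞) ∂(A.runLaw p) :=
        (lintegral_finsetSum _ fun τ _ => hmeas τ).symm
    _ ≤ A.expectedCalls p x w := by
        refine lintegral_mono fun r => ?_
        simp only
        rw [ENNReal.finsetSum_iSup_of_monotone]
        · refine iSup_mono fun k => ?_
          exact_mod_cast A.sum_callCount_le hT x w r.1 r.2 k
        · intro τ k l hkl
          exact Nat.cast_le.2 (A.callCount_mono (T τ) x w r.1 r.2 hkl)

/-! ### Reliable algorithms -/

variable {A} {p : unitInterval} {c : ℝ}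

instance : IsProbabilityMeasure (A.runLaw p) := by
  unfold runLaw
  infer_instance

theorem SolvesWithHighProbability.le_outputs_false (hA : A.SolvesWithHighProbability p c)
    {x : Fin n → Plane} (hx : Function.Injective x) {w : Query n → SignType}
    (hw : IsErrorRule x w) (hcol : ¬ HasCollinearTriple x) :
    ENNReal.ofReal (1 - (n : ℝ) ^ (-c)) ≤ A.runLaw p {r | A.Outputs x w r.1 r.2 false} := by
  refine (hA x hx w hw).trans (measure_mono ?_)
  rintro r ⟨b, hb, hb'⟩
  cases b
  · exact hb
  · exact absurd (hb'.1 rfl) hcol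

theorem SolvesWithHighProbability.outputs_false_le (hA : A.SolvesWithHighProbability p c)
    {x : Fin n → Plane} (hx : Function.Injective x) {w : Query n → SignType}
    (hw : IsErrorRule x w) (hcol : HasCollinearTriple x) :
    A.runLaw p {r | A.Outputs x w r.1 r.2 false} ≤ ENNReal.ofReal ((n : ℝ) ^ (-c)) := by
  have hsub : {r : A.Seed × (ℕ → Bool) | ∃ b, A.Outputs x w r.1 r.2 b ∧
      (b = true ↔ HasCollinearTriple x)} ⊆ {r | A.Outputs x w r.1 r.2 false}ᶜ := by
    rintro r ⟨b, hb, hb'⟩ h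
    have := A.outputs_unique hb h
    rw [hb'.2 hcol] at this
    exact Bool.noConfusion this
  have h1 := (hA x hx w hw).trans (measure_mono hsub)
  rw [prob_compl_eq_one_sub (A.measurableSet_outputs x w false)] at h1
  have h2 : ENNReal.ofReal (1 - (n : ℝ) ^ (-c)) = 1 - ENNReal.ofReal ((n : ℝ) ^ (-c)) := by
    rw [ENNReal.ofReal_sub _ (by positivity), ENNReal.ofReal_one]
  rw [h2] at h1
  have h3 : A.runLaw p {r | A.Outputs x w r.1 r.2 false} ≤ 1 := prob_le_one
  rw [ENNReal.le_sub_iff_add_le_right (ne_top_of_le_ne_top ENNReal.one_ne_top h3) h3] at h1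
  by_contra! hlt
  -- Subtraction is truncated here; this inequality holds even if `n ^ (-c)` exceeds `1`.
  have h4 : (1 : ℝ≥0∞) ≤ 1 - ENNReal.ofReal ((n : ℝ) ^ (-c)) + ENNReal.ofReal ((n : ℝ) ^ (-c)) :=
    le_tsub_add
  have h5 : 1 - ENNReal.ofReal ((n : ℝ) ^ (-c)) ≠ ⊤ :=
    ne_top_of_le_ne_top ENNReal.one_ne_top tsub_le_self
  exact absurd (h4.trans_lt (ENNReal.add_lt_add_left h5 hlt)) (not_lt.2 h1)

end RandomizedAlgorithm

/-! ### The logarithmic bound for one triple, and the conclusion. -/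

theorem bernoulliMeasure_le_mul_not {p : unitInterval} (hp_pos : 0 < (p : ℝ))
    (hp_lt : (p : ℝ) < 1 / 2) (b : Bool) :
    bernoulliMeasure true false p {b} ≤
      ENNReal.ofReal ((1 - p) / p) * bernoulliMeasure true false p {!b} := by
  have hnn : (0 : ℝ) ≤ (1 - p) / p := by
    have : (p : ℝ) ≤ 1 := p.2.2
    exact div_nonneg (by linarith) hp_pos.le
  have key : (bernoulliMeasure true false p).real {b} ≤
      (1 - p) / p * (bernoulliMeasure true false p).real {!b} := by
    cases b
    · rw [bernoulliMeasure_real_apply_of_notMem_of_mem p (measurableSet_singleton _) (by simp)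
        (by simp), bernoulliMeasure_real_apply_of_mem_of_notMem p (measurableSet_singleton _)
        (by simp) (by simp), div_mul_cancel₀ _ hp_pos.ne']
    · rw [bernoulliMeasure_real_apply_of_mem_of_notMem p (measurableSet_singleton _) (by simp)
        (by simp), bernoulliMeasure_real_apply_of_notMem_of_mem p (measurableSet_singleton _)
        (by simp) (by simp), div_mul_eq_mul_div, le_div_iff₀ hp_pos]
      nlinarith
  rw [← ofReal_measureReal, ← ofReal_measureReal (s := {!b}), ← ENNReal.ofReal_mul hnn]
  exact ENNReal.ofReal_le_ofReal key

/-- Each collapsible triple has to be called a logarithmic number of times with probability at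
least one half. -/
theorem RandomizedAlgorithm.half_le_runLaw_callCount {n : ℕ} {A : RandomizedAlgorithm.{u} n}
    {p : unitInterval} (hp_pos : 0 < (p : ℝ)) (hp_lt : (p : ℝ) < 1 / 2) {c : ℝ}
    (hA : A.SolvesWithHighProbability p c) {x y : Fin n → Plane} {T : Set (Query n)}
    (hx : Function.Injective x) (hxcol : ¬ HasCollinearTriple x)
    (hx0 : ∀ q, trueAnswer x q ≠ 0) (hy : Function.Injective y) (hycol : HasCollinearTriple y)
    (hT : ∀ q ∈ T, trueAnswer y q = 0) (hT' : ∀ q ∉ T, trueAnswer y q = trueAnswer x q)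
    {m : ℕ} (hm : (n : ℝ) ^ (-c) + ((1 - p) / p : ℝ) ^ m * (n : ℝ) ^ (-c) ≤ 1 / 2) :
    ENNReal.ofReal (1 / 2) ≤
      A.runLaw p {r | ∃ k, m + 1 ≤ A.callCount T x (fun _ => 0) r.1 r.2 k} := by
  classical
  set w : Query n → SignType := fun _ => 0 with hw
  -- On `T` the correct and erroneous answers for `y` are those for `x` interchanged; off `T` they
  -- agree.
  set w' : Query n → SignType := fun q => if q ∈ T then trueAnswer x q else 0 with hw'
  have hwx : IsErrorRule x w := fun q => (hx0 q).symm
  have hwy : IsErrorRule y w' := by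
    intro q
    by_cases hq : q ∈ T
    · simpa [hw', hq, hT q hq] using hx0 q
    · simpa [hw', hq, hT' q hq] using (hx0 q).symm
  have hmem : ∀ q ∈ T, ∀ b, noisyAnswer y w' q (!b) = noisyAnswer x w q b := by
    intro q hq b
    cases b <;> simp [noisyAnswer, hw, hw', hq, hT q hq]
  have hnmem : ∀ q ∉ T, ∀ b, noisyAnswer y w' q b = noisyAnswer x w q b := by
    intro q hq b
    cases b <;> simp [noisyAnswer, hw, hw', hq, hT' q hq]
  have hr : (1 : ℝ) ≤ (1 - p) / p := by
    rw [le_div_iff₀ hp_pos]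
    linarith
  have h1 := hA.le_outputs_false hx hwx hxcol
  have h2 := hA.outputs_false_le hy hwy hycol
  have h3 := A.runLaw_outputs_le hmem hnmem p (ENNReal.one_le_ofReal.2 hr)
    (bernoulliMeasure_le_mul_not hp_pos hp_lt) false m
  have h4 : ENNReal.ofReal (1 - (n : ℝ) ^ (-c)) ≤
      ENNReal.ofReal (((1 - p) / p : ℝ) ^ m * (n : ℝ) ^ (-c)) +
        A.runLaw p {r | ∃ k, m + 1 ≤ A.callCount T x w r.1 r.2 k} := by
    refine (h1.trans h3).trans ?_
    rw [ENNReal.ofReal_mul (by positivity), ENNReal.ofReal_pow (by positivity)]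
    gcongr
  rw [← tsub_le_iff_left, ← ENNReal.ofReal_sub _ (by positivity)] at h4
  exact le_trans (ENNReal.ofReal_le_ofReal (by linarith)) h4

end NoisyCollinearity

theorem mainTheorem11 (p : unitInterval) (hp_pos : 0 < (p : ℝ)) (hp_lt : (p : ℝ) < 1 / 2)
    (c : ℝ) (hc : 0 < c) :
    ∃ C : ℝ, 0 < C ∧ ∃ N : ℕ, ∀ n : ℕ, N ≤ n →
      ∀ A : NoisyCollinearity.RandomizedAlgorithm.{u} n, A.SolvesWithHighProbability p c →
        ∃ x : Fin n → NoisyCollinearity.Plane, Function.Injective x ∧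
          ∃ w : NoisyCollinearity.Query n → SignType, NoisyCollinearity.IsErrorRule x w ∧
            ENNReal.ofReal (C * (n : ℝ) ^ 2 * Real.log n) ≤ A.expectedCalls p x w := by
  set r : ℝ := (1 - p) / p with hr
  have hr1 : 1 < r := by
    rw [hr, lt_div_iff₀ hp_pos]
    linarith
  have hlogr : 0 < Real.log r := Real.log_pos hr1
  have hlim : Filter.Tendsto (fun n : ℕ => (n : ℝ) ^ (-(c / 2))) Filter.atTop (nhds 0) :=
    (tendsto_rpow_neg_atTop (half_pos hc)).comp tendsto_natCast_atTop_atTop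
  obtain ⟨N, hN⟩ := Filter.eventually_atTop.1
    (hlim.eventually (ge_mem_nhds (show (0 : ℝ) < 1 / 4 by norm_num)))
  -- The constant is `(1/8)² * (c/2) * (1/2) / log r`: the bound `n / 4 ≥ n / 8` for the floored
  -- quotient, valid from `n = 4` on, the number of calls per triple, and their probability `1/2`.
  refine ⟨c / (256 * Real.log r), by positivity, max N 4, fun n hn A hA => ?_⟩
  have hn4 : 4 ≤ n := le_trans (le_max_right _ _) hn
  have hnR : (4 : ℝ) ≤ n := by exact_mod_cast hn4
  have hsmall : (n : ℝ) ^ (-(c / 2)) ≤ 1 / 4 := hN n (le_trans (le_max_left _ _) hn)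
  have hlogn : 0 ≤ Real.log n := Real.log_nonneg (by linarith)
  obtain ⟨x, y, T, hx, hxcol, hx0, hy, hycol, hT, hT', hdisj⟩ :=
    NoisyCollinearity.exists_collapsible_configuration (n := n) (m := n / 4) (by omega)
  refine ⟨x, hx, fun _ => 0, fun q => (hx0 q).symm, ?_⟩
  -- The floor keeps `r ^ m ≤ n ^ (c / 2)`, while the count of `m + 1` calls recovers what rounding
  -- loses.
  set m : ℕ := ⌊c / 2 * Real.log n / Real.log r⌋₊ with hmdef
  have hm_le : (m : ℝ) * Real.log r ≤ c / 2 * Real.log n := by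
    rw [← le_div_iff₀ hlogr]
    exact Nat.floor_le (by positivity)
  have hm_ge : c / 2 * Real.log n / Real.log r ≤ m + 1 := (Nat.lt_floor_add_one _).le
  have hpow : r ^ m ≤ (n : ℝ) ^ (c / 2) := by
    rw [← Real.log_le_log_iff (by positivity) (by positivity), Real.log_pow,
      Real.log_rpow (by positivity)]
    exact hm_le
  have hsplit : (n : ℝ) ^ (-c) = (n : ℝ) ^ (-(c / 2)) * (n : ℝ) ^ (-(c / 2)) := by
    rw [← Real.rpow_add (by positivity)]
    congr 1
    ring
  have hcancel : (n : ℝ) ^ (c / 2) * (n : ℝ) ^ (-c) = (n : ℝ) ^ (-(c / 2)) := by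
    rw [← Real.rpow_add (by positivity)]
    congr 1
    ring
  have hfail : (n : ℝ) ^ (-c) + r ^ m * (n : ℝ) ^ (-c) ≤ 1 / 2 := by
    have h0 : 0 ≤ (n : ℝ) ^ (-(c / 2)) := by positivity
    have h1 : r ^ m * (n : ℝ) ^ (-c) ≤ (n : ℝ) ^ (-(c / 2)) := by
      rw [← hcancel]
      gcongr
    have h2 : (n : ℝ) ^ (-c) ≤ 1 / 4 := by
      rw [hsplit]
      nlinarith
    linarith
  have hquarter : (n : ℝ) / 8 ≤ ((n / 4 : ℕ) : ℝ) := by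
    have : n ≤ 8 * (n / 4) := by omega
    have : (n : ℝ) ≤ 8 * ((n / 4 : ℕ) : ℝ) := by exact_mod_cast this
    linarith
  refine le_trans ?_ (A.sum_measure_callCount_le_expectedCalls hdisj p x (fun _ => 0) (m + 1))
  calc ENNReal.ofReal (c / (256 * Real.log r) * (n : ℝ) ^ 2 * Real.log n)
      ≤ ENNReal.ofReal (((n / 4 * (n / 4) : ℕ) : ℝ) * (((m + 1 : ℕ) : ℝ) * (1 / 2))) := by
        refine ENNReal.ofReal_le_ofReal ?_
        calc c / (256 * Real.log r) * (n : ℝ) ^ 2 * Real.log n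
            = n / 8 * (n / 8) * (c / 2 * Real.log n / Real.log r * (1 / 2)) := by
              field_simp
              ring
          _ ≤ _ := by
              push_cast
              gcongr
    _ = ∑ _τ : Fin (n / 4) × Fin (n / 4), ((m + 1 : ℕ) : ENNReal) * ENNReal.ofReal (1 / 2) := by
        rw [Finset.sum_const, Finset.card_univ, Fintype.card_prod, Fintype.card_fin, nsmul_eq_mul,
          ENNReal.ofReal_mul (by positivity), ENNReal.ofReal_mul (by positivity),
          ENNReal.ofReal_natCast, ENNReal.ofReal_natCast]
    _ ≤ _ := by
        refine Finset.sum_le_sum fun τ _ => ?_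
        gcongr
        exact NoisyCollinearity.RandomizedAlgorithm.half_le_runLaw_callCount hp_pos hp_lt hA hx hxcol hx0 (hy τ)
          (hycol τ) (hT τ) (hT' τ) hfail
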